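/- \textbf{Instruction sequences.} Let $\mathbb B=\{T,F\}$. The basic instructions are $f.m$, where the focus $f$ names a Boolean register (an input register $\mathsf{in}{:}i$, an auxiliary register $\mathsf{aux}{:}i$ ($i\ge 1$), or the output register $\mathsf{out}$) and the method $m$ is $\mathsf{set}{:}T$, $\mathsf{set}{:}F$ or $\mathsf{get}$, together with a splitting instruction $\mathsf{split}(p)$ and a direct replying instruction $\mathsf{reply}(p)$ for each Boolean parameter $p$ from a countably infinite set. The primitive instructions are $a$, $+a$, $-a$ ($a$ a basic instruction), the forward jumps $\#l$ ($l\in\mathbb N$) and the termination instruction $!$. Let $\mathrm{SIS}$ be the set of all finite non-empty sequences $X$ of primitive instructions whose basic instructions are among $\mathsf{in}{:}i.\mathsf{get}$, $\mathsf{out}.\mathsf{set}{:}T$, $\mathsf{split}(p)$, $\mathsf{reply}(p)$; $|X|$ is the length of $X$. \textbf{Threads.} Finite threads are built from termination $S$ and deadlock $D$ by $\tau\circ x$ (do an internal step, proceed as $x$) and $x\trianglelefteq a\trianglerighteq y$ (perform the basic instruction $a$, proceed as $x$ on reply $T$ and as $y$ on reply $F$). The thread $|X|_{\mathrm{thr}}$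 of $X$ (a sequence that is left without further instructions deadlocks) is given by: $a;X'$ yields $x\trianglelefteq a\trianglerighteq x$, $+a;X'$ yields $x\trianglelefteq a\trianglerighteq x'$ and $-a;X'$ yields $x'\trianglelefteq a\trianglerighteq x$, where $x$ is the thread of $X'$ and $x'$ that of $X'$ without its first instruction; $\#0;X'$ yields $D$; $\#(l{+}1);X'$ yields the thread of $X'$ without its first $l$ instructions; $!;X'$ yields $S$. For a parameter $p$ and $b\in\mathbb B$, the instantiation $I^b_p(x)$ commutes with all thread constructors, except that $I^b_p(x\trianglelefteq\mathsf{split}(p)\trianglerighteq y)=D$, $I^T_p(x\trianglelefteq\mathsf{reply}(p)\trianglerighteq y)=\tau\circ I^T_p(x)$ and $I^F_p(x\trianglelefteq\mathsf{reply}(p)\trianglerighteq y)=\tau\circ I^F_p(y)$. Let $S_D(x)$ be $x$ with every $S$ replaced by $D$. Cyclic interleaving with thread splitting maps a finite sequence of threads to a thread: $\|(\langle\rangle)=S$, $\|(\langle S\rangle\alpha)=\|(\alpha)$, $\|(\langle D\rangle\alpha)=S_D(\|(\alpha))$, $\|(\langle\tau\circ x\rangle\alpha)=\tau\circ\|(\alpha\langle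 x\rangle)$, $\|(\langle x\trianglelefteq f.m\trianglerighteq y\rangle\alpha)=\|(\alpha\langle x\rangle)\trianglelefteq f.m\trianglerighteq\|(\alpha\langle y\rangle)$, $\|(\langle x\trianglelefteq\mathsf{split}(p)\trianglerighteq y\rangle\alpha)=\tau\circ\|(\alpha\langle I^T_p(x)\rangle\langle I^F_p(y)\rangle)$, and $\|(\langle x\trianglelefteq\mathsf{reply}(p)\trianglerighteq y\rangle\alpha)=S_D(\|(\alpha))$. \textbf{Computing.} $BR_b$ is the Boolean register service with contents $b$: $\mathsf{set}{:}b'$ makes the contents $b'$ and replies $b'$, and $\mathsf{get}$ replies the contents. The use operator $x/_f H$ lets the service $H$ process all actions $f.m$ of the thread $x$, turning each of them into $\tau$ followed by the branch selected by the reply (into $D$ if the request is rejected), and leaves the other actions alone. The apply operator $x\bullet_f H$ gives the service into which $H$ is turned when it processes all actions $f.m$ of $x$ until $x$ terminates; it gives the divergent service (which rejects every request, and differs from every $BR_b$) if $x$ deadlocks, performs an action $g.m$ with $g\ne f$, or has a request rejected. $X\in\mathrm{SIS}$ \emph{splitting computes} $f:\mathbb B^n\to\mathbb B$ if for all $b_1,\dots,b_n\in\mathbb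 B$ $$\bigl(\cdots(\|(\langle|X|_{\mathrm{thr}}\rangle)/_{\mathsf{in}:1}BR_{b_1})\cdots/_{\mathsf{in}:n}BR_{b_n}\bigr)\bullet_{\mathsf{out}}BR_F=BR_{f(b_1,\dots,b_n)} .$$ $\mathrm{PL\text{-}SIS}$ is the class of all Boolean function families $(f_n)_{n\in\mathbb N}$, $f_n:\mathbb B^n\to\mathbb B$, for which there is a polynomial $h$ such that for every $n\in\mathbb N$ some $X\in\mathrm{SIS}$ with $|X|\le h(n)$ splitting computes $f_n$. \textbf{Classical classes.} $\mathrm{P/poly}$ is the class of all $g:\mathbb B^*\to\mathbb B$ for which there is a polynomial $h$ such that for every $n$ the restriction of $g$ to $\mathbb B^n$ is computed by a Boolean circuit (NOT-, OR- and AND-gates and constants) with at most $h(n)$ nodes. $\mathrm{NP/poly}$ is the class of all $f:\mathbb B^*\to\mathbb B$ that have a checking function in $\mathrm{P/poly}$: there are $k\in\mathbb N$ and $g\in\mathrm{P/poly}$ such that for all $w\in\mathbb B^*$ $$f(w)=T\iff\exists c\in\mathbb B^*\ \bigl(|c|\le|w|^k\ \wedge\ g(\langle w,c\rangle)=T\bigr),$$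 where $\langle w,c\rangle$ is the string consisting of $w$ with every bit doubled, then $FT$, then $c$. \textbf{Theorem.} Identify each Boolean function family $(f_n)_{n\in\mathbb N}$ with the function $f:\mathbb B^*\to\mathbb B$ such that $f(w)=f_n(w)$ for all $n\in\mathbb N$ and $w\in\mathbb B^n$. Then $\mathrm{PL\text{-}SIS}=\mathrm{NP/poly}$. -/

import Mathlib

namespace SplitInstr

/-! ### Foci, methods, basic instructions, primitive instructions -/

/-- Names of the Boolean registers. Registers are counted from zero here: `inp i` is the
input register `in:(i+1)` and `aux i` is the auxiliary register `aux:(i+1)`. -/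
inductive Focus : Type
  | inp (i : ℕ)
  | aux (i : ℕ)
  | out
  deriving DecidableEq

/-- The methods of Boolean registers: `set b` is "set to `b`", `get` reads the contents. -/
inductive Method : Type
  | set (b : Bool)
  | get
  deriving DecidableEq

/-- Basic instructions (also taken as the actions of threads): `act f m` is `f.m`, `split p` and
`reply p` are the splitting and the direct replying instruction for the Boolean parameter `p`. -/
inductive Basic : Type
  | act (f : Focus) (m : Method)
  | split (p : ℕ)
  | reply (p : ℕ)
  deriving DecidableEq

/-- Primitive instructions: plain basic instructions `a`, positive tests `+a`, negative
tests `-a`, forward jumps `#l` and the termination instruction `!`. -/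
inductive Prim : Type
  | plain (a : Basic)
  | ptst (a : Basic)
  | ntst (a : Basic)
  | jmp (l : ℕ)
  | halt

/-! ### Threads and thread extraction -/

/-- Finite threads. `pcc x a y` is the postconditional composition `x ⊴ a ⊵ y`: perform `a`, then
proceed as `x` on a positive reply and as `y` on a negative reply. The internal action is unary,
`tau x` being `tau ∘ x`, because of the axiom `x ⊴ tau ⊵ y = x ⊴ tau ⊵ x`. -/
inductive Thread : Type
  | terminated
  | dead
  | tau (x : Thread)
  | pcc (x : Thread) (a : Basic) (y : Thread)

/-- Thread extraction. The empty list (not itself an instruction sequence) is given the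
value deadlock, so that running off the end of a sequence is deadlock. -/
def extract : List Prim → Thread
  | [] => .dead
  | .plain a :: x => .pcc (extract x) a (extract x)
  | .ptst a :: x => .pcc (extract x) a (extract (x.drop 1))
  | .ntst a :: x => .pcc (extract (x.drop 1)) a (extract x)
  | .jmp 0 :: _ => .dead
  | .jmp (l + 1) :: x => extract (x.drop l)
  | .halt :: _ => .terminated
termination_by x => x.length
decreasing_by all_goals (simp only [List.length_drop, List.length_cons]; omega)

/-! The usual defining equations of thread extraction hold. -/

theorem extract_ptst (a : Basic) (x : List Prim) :
    extract (.ptst a :: x) = .pcc (extract x) a (extract (.jmp 2 :: x)) := by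
  simp [extract]

theorem extract_ntst (a : Basic) (x : List Prim) :
    extract (.ntst a :: x) = .pcc (extract (.jmp 2 :: x)) a (extract x) := by
  simp [extract]

theorem extract_jmp_one (x : List Prim) : extract (.jmp 1 :: x) = extract x := by
  simp [extract]

theorem extract_jmp_single (l : ℕ) : extract [.jmp l] = .dead := by
  cases l <;> simp [extract]

theorem extract_jmp_add_two (l : ℕ) (u : Prim) (x : List Prim) :
    extract (.jmp (l + 2) :: u :: x) = extract (.jmp (l + 1) :: x) := by
  simp [extract]

namespace Thread

/-! ### Parameter instantiation, deadlock at termination, cyclic interleaving -/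

/-- Instantiation of the Boolean parameter `p` to `b` in a thread. -/
def insta (p : ℕ) (b : Bool) : Thread → Thread
  | terminated => terminated
  | dead => dead
  | tau x => tau (insta p b x)
  | pcc x (.act f m) y => pcc (insta p b x) (.act f m) (insta p b y)
  | pcc x (.split q) y => if p = q then dead else pcc (insta p b x) (.split q) (insta p b y)
  | pcc x (.reply q) y =>
      if p = q then
        match b with
        | true => tau (insta p b x)
        | false => tau (insta p b y)
      else pcc (insta p b x) (.reply q) (insta p b y)

/-- Turning termination into deadlock. -/
def std : Thread → Thread
  | terminated => dead
  | dead => dead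
  | tau x => tau (std x)
  | pcc x a y => pcc (std x) a (std y)

/-- Number of nodes of a thread (only used for the termination of `csi`). -/
def nodes : Thread → ℕ
  | terminated => 1
  | dead => 1
  | tau x => nodes x + 1
  | pcc x _ y => nodes x + nodes y + 1

theorem one_le_nodes (x : Thread) : 1 ≤ x.nodes := by
  cases x <;> simp [nodes]

theorem nodes_insta_le (p : ℕ) (b : Bool) (x : Thread) : (x.insta p b).nodes ≤ x.nodes := by
  induction x with
  | terminated => simp [insta, nodes]
  | dead => simp [insta, nodes]
  | tau x ih => simp only [insta, nodes]; omega
  | pcc x a y ihx ihy =>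
    cases a with
    | act f m => simp only [insta, nodes]; omega
    | split q =>
      simp only [insta]
      split <;> simp only [nodes] <;> omega
    | reply q =>
      simp only [insta]
      split
      · cases b <;> simp only [nodes] <;> omega
      · simp only [nodes]; omega

/-- Cyclic interleaving, with thread splitting, of a thread vector. -/
def csi : List Thread → Thread
  | [] => terminated
  | terminated :: α => csi α
  | dead :: α => std (csi α)
  | tau x :: α => tau (csi (α ++ [x]))
  | pcc x (.act f m) y :: α => pcc (csi (α ++ [x])) (.act f m) (csi (α ++ [y]))
  | pcc x (.split p) y :: α => tau (csi (α ++ [x.insta p true] ++ [y.insta p false]))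
  | pcc _ (.reply _) _ :: α => std (csi α)
termination_by α => (α.map nodes).sum
decreasing_by
  all_goals
    simp only [List.map_cons, List.map_append, List.map_nil, List.sum_cons, List.sum_append,
      List.sum_nil, nodes]
  · omega
  · omega
  · omega
  · omega
  · omega
  · have := nodes_insta_le p true x
    have := nodes_insta_le p false y
    omega
  · omega

end Thread

/-! ### Services; the use and apply operators -/

/-- Services. A reply is `some true`, `some false`, or `none` for "request rejected". -/
structure Service where
  State : Type
  eff : Method → State → State
  yld : Method → State → Option Bool
  start : State
  rejects : ∀ m s, yld m s = none → ∀ m', yld m' (eff m s) = none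

/-- The derived service after processing `m`. -/
def Service.derive (H : Service) (m : Method) : Service :=
  { H with start := H.eff m H.start }

/-- The reply of a service to `m`. -/
def Service.reply (H : Service) (m : Method) : Option Bool :=
  H.yld m H.start

/-- The effect (and yield) function of Boolean registers. -/
def regEff : Method → Option Bool → Option Bool
  | _, none => none
  | .set b, some _ => some b
  | .get, some b => some b

/-- The Boolean register service with initial state `s`. -/
def BR (s : Option Bool) : Service where
  State := Option Bool
  eff := regEff
  yld := regEff
  start := s
  rejects := by
    intro m s h m'
    rw [h]
    cases m' <;> rfl

/-- The divergent service: it rejects every request. -/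
def divServ : Service := BR none

namespace Thread

/-- The use operator `x / f H`: all actions `f.m` of the thread are processed by `H`. Threads
obtained by cyclic interleaving contain no actions `split p`, `reply p`; on other threads
such actions are left alone. -/
def use (f : Focus) : Thread → Service → Thread
  | terminated, _ => terminated
  | dead, _ => dead
  | tau x, H => tau (use f x H)
  | pcc x (.act g m) y, H =>
      if g = f then
        match H.reply m with
        | some true => tau (use f x (H.derive m))
        | some false => tau (use f y (H.derive m))
        | none => dead
      else pcc (use f x H) (.act g m) (use f y H)
  | pcc x (.split p) y, H => pcc (use f x H) (.split p) (use f y H)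
  | pcc x (.reply p) y, H => pcc (use f x H) (.reply p) (use f y H)

/-- The apply operator `x • f H`: the service that results from processing the actions `f.m`
of the thread by `H`; any other action than `f.m` or `tau` results in the divergent service. -/
def apply (f : Focus) : Thread → Service → Service
  | terminated, H => H
  | dead, _ => divServ
  | tau x, H => apply f x H
  | pcc x (.act g m) y, H =>
      if g = f then
        match H.reply m with
        | some true => apply f x (H.derive m)
        | some false => apply f y (H.derive m)
        | none => divServ
      else divServ
  | pcc _ (.split _) _, _ => divServ
  | pcc _ (.reply _) _, _ => divServ

/-- `( … (x / in:1 BR_{b₁}) … / in:n BR_{bₙ})`. -/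
def useInputs {n : ℕ} (x : Thread) (b : Fin n → Bool) : Thread :=
  (List.finRange n).foldl (fun y (i : Fin n) => use (.inp i) y (BR (some (b i)))) x

end Thread

/-! ### The class of families computed by polynomial-length splitting sequences -/

/-- The basic instructions allowed in splitting instruction sequences. -/
def AllowedBasic : Basic → Prop
  | .act (.inp _) .get => True
  | .act .out (.set true) => True
  | .split _ => True
  | .reply _ => True
  | _ => False

/-- Primitive instructions all of whose basic instructions are allowed. -/
def AllowedPrim : Prim → Prop
  | .plain a => AllowedBasic a
  | .ptst a => AllowedBasic a
  | .ntst a => AllowedBasic a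
  | .jmp _ => True
  | .halt => True

/-- Splitting instruction sequences acting on Boolean registers: finite non-empty sequences of
allowed primitive instructions. -/
def SISbr : Set (List Prim) := {X | X ≠ [] ∧ ∀ u ∈ X, AllowedPrim u}

/-- `X` splitting computes the `n`-ary Boolean function `f`. -/
def SplittingComputes {n : ℕ} (X : List Prim) (f : (Fin n → Bool) → Bool) : Prop :=
  ∀ b : Fin n → Bool,
    (((Thread.csi [extract X]).useInputs b).apply .out (BR (some false))) = BR (some (f b))

/-- Boolean function families `(fₙ)`, with `fₙ` an `n`-ary Boolean function for every `n`. -/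
abbrev BoolFamily : Type := (n : ℕ) → (Fin n → Bool) → Bool

/-- The class PL-SIS. -/
def PLSIS : Set BoolFamily :=
  {f | ∃ h : Polynomial ℕ, ∀ n : ℕ, ∃ X ∈ SISbr,
    SplittingComputes X (f n) ∧ X.length ≤ h.eval n}

/-- The identification of Boolean function families with functions on bit strings:
`(fₙ)` corresponds to the function `f` with `f w = fₙ w` for all `w` of length `n`. -/
def familyEquiv : BoolFamily ≃ (List Bool → Bool) where
  toFun f w := f w.length w.get
  invFun F n b := F (List.ofFn b)
  left_inv f := by
    have key : ∀ (m n : ℕ) (h : m = n) (c : Fin m → Bool) (b : Fin n → Bool),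
        (∀ i, c i = b (Fin.cast h i)) → f m c = f n b := by
      rintro m n rfl c b hcb
      exact congrArg (f m) (funext hcb)
    funext n b
    exact key _ _ (List.length_ofFn) _ _ (fun i => by simp; rfl)
  right_inv F := by
    funext w
    exact congrArg F (List.ofFn_get w)

/-! ### Boolean circuits, P/poly, NP/poly -/

/-- A gate of a circuit with `n` inputs, placed after `k` earlier gates; its direct predecessors
are inputs or earlier gates. Constant gates serve circuits without inputs. -/
inductive Gate (n k : ℕ) : Type
  | const (b : Bool)
  | not (u : Fin n ⊕ Fin k)
  | and (u v : Fin n ⊕ Fin k)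
  | or (u v : Fin n ⊕ Fin k)

/-- The value of a gate, given the values of the inputs and of the earlier gates. -/
def Gate.eval {n k : ℕ} (x : Fin n → Bool) (y : Fin k → Bool) : Gate n k → Bool
  | .const b => b
  | .not u => !(Sum.elim x y u)
  | .and u v => Sum.elim x y u && Sum.elim x y v
  | .or u v => Sum.elim x y u || Sum.elim x y v

/-- The gates of an acyclic circuit with `n` inputs and `k` gates, in topological order. -/
inductive Gates (n : ℕ) : ℕ → Type
  | nil : Gates n 0
  | snoc {k : ℕ} (C : Gates n k) (g : Gate n k) : Gates n (k + 1)

/-- The values of all gates on a given input. -/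
def Gates.eval {n : ℕ} (x : Fin n → Bool) : {k : ℕ} → Gates n k → (Fin k → Bool)
  | _, .nil => Fin.elim0
  | _, .snoc C g => Fin.snoc (α := fun _ => Bool) (C.eval x) (g.eval x (C.eval x))

/-- Boolean circuits with `n` inputs and one output node. -/
structure Circuit (n : ℕ) where
  numGates : ℕ
  gates : Gates n numGates
  output : Fin n ⊕ Fin numGates

/-- The Boolean function computed by a circuit. -/
def Circuit.eval {n : ℕ} (C : Circuit n) (x : Fin n → Bool) : Bool :=
  Sum.elim x (C.gates.eval x) C.output

/-- The size of a circuit: its number of nodes. -/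
def Circuit.size {n : ℕ} (C : Circuit n) : ℕ := n + C.numGates

/-- P/poly: the functions on bit strings computed by polynomial-size Boolean circuits. -/
def PPoly : Set (List Bool → Bool) :=
  {F | ∃ h : Polynomial ℕ, ∀ n : ℕ, ∃ C : Circuit n,
    (∀ x : Fin n → Bool, C.eval x = F (List.ofFn x)) ∧ C.size ≤ h.eval n}

/-- The usual encoding of a pair of bit strings as one bit string: the bits of the first string
doubled, the separator `01`, and the second string. -/
def pairCode (w c : List Bool) : List Bool :=
  w.flatMap (fun b => [b, b]) ++ [false, true] ++ c

/-- `g` is a checking function for `F`, with certificates of length at most `|w| ^ k`. -/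
def IsChecking (k : ℕ) (g F : List Bool → Bool) : Prop :=
  ∀ w : List Bool, F w = true ↔
    ∃ c : List Bool, c.length ≤ w.length ^ k ∧ g (pairCode w c) = true

/-- NP/poly: the functions on bit strings that have a checking function in P/poly. -/
def NPPoly : Set (List Bool → Bool) :=
  {F | ∃ k : ℕ, ∃ g ∈ PPoly, IsChecking k g F}

end SplitInstr

/-!
The two classes coincide because the splitting instruction is nondeterministic guessing.

Input registers are only read and the output register is only set to `true`, so the order in
which the interleaved threads take their steps is immaterial: processing the interleaved threads
either diverges (some thread deadlocks) or leaves in the output register the disjunction over all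
threads of "this thread sets the output register". This is `Thread.outcome_csi`, stated with the
compositional semantics `Thread.run`. A parameter can be split at most once in the history of a
thread, so, in the absence of deadlock, the threads correspond to the paths that are selected by
assignments of truth values to the parameters (`Thread.run_eq_some`). Hence a sequence
that splitting computes `f` yields `f b` exactly if *some* assignment makes its path set the output
register.

From instruction sequences to circuits: jumps go forward, so for a given input and
assignment the path can be evaluated by a circuit of linear size that works through the sequence
from its end (`Realizable.insert_path`), and the assignment serves as certificate. Certificates are
taken to have a length that is determined by the length of the input, so that for each length of
codes of pairs there is at most one way to split them (`mem_NPPoly_of_verifiable`). As `1 ^ k` and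
`0 ^ k` do not grow with `k`, inputs of length at most one are hard-wired.

From circuits to instruction sequences: there are no auxiliary registers to hold gate values, so the
gate values are guessed by splitting, along with the certificate. What remains is to evaluate a
formula of polynomial size, saying that for one of the possible certificate lengths the guessed gate
values are right and the output node is `true` (`Circuit.form`). A formula is
evaluated by a sequence of tests and jumps of linear length (`Form.seg`, `Form.extract_seg`), which
leads to deadlock on no path.
-/

namespace SplitInstr

/-! ### Deadlock-or-output semantics of threads -/

namespace Thread

/-- The outcome of running a thread together with all threads that it splits off, where `β i` is
the contents of the input register `inp i` (`none` if there is no such register) and `σ p` is the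
value to which the parameter `p` has been instantiated (`none` if it has not been).
It is `none` if one of the threads deadlocks, and otherwise `some v`, where `v` tells
whether one of them sets the output register. -/
def run (β : ℕ → Option Bool) : (ℕ → Option Bool) → Thread → Option Bool
  | _, terminated => some false
  | _, dead => none
  | σ, tau x => run β σ x
  | σ, pcc x (.act f m) y =>
      match f, m with
      | .inp i, .get => (β i).bind fun v => cond v (run β σ x) (run β σ y)
      | .out, .set true => (run β σ x).map fun _ => true
      | _, _ => none
  | σ, pcc x (.split p) y =>
      if σ p = none then
        Option.map₂ or (run β (Function.update σ p (some true)) x)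
          (run β (Function.update σ p (some false)) y)
      else none
  | σ, pcc x (.reply p) y => (σ p).bind fun v => cond v (run β σ x) (run β σ y)

/-- Instantiating a parameter in a thread amounts to recording its value in the environment. -/
theorem run_insta (β : ℕ → Option Bool) (p : ℕ) (v : Bool) (x : Thread) (σ : ℕ → Option Bool)
    (hσ : σ p = none) : run β σ (insta p v x) = run β (Function.update σ p (some v)) x := by
  induction x generalizing σ with
  | terminated => rfl
  | dead => rfl
  | tau x ih => exact ih σ hσ
  | pcc x a y ihx ihy =>
    cases a with
    | act f m => simp only [insta, run, ihx σ hσ, ihy σ hσ]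
    | split q =>
      by_cases hpq : p = q
      · subst hpq
        simp [insta, run]
      · have hqp : q ≠ p := fun h => hpq h.symm
        have hup (w : Option Bool) : Function.update σ q w p = none := by
          rw [Function.update_of_ne hpq, hσ]
        simp only [insta, if_neg hpq, run, Function.update_of_ne hqp, ihx _ (hup _),
          ihy _ (hup _), Function.update_comm hqp]
    | reply q =>
      by_cases hpq : p = q
      · subst hpq
        cases v <;> simp [insta, run, ihx σ hσ, ihy σ hσ]
      · have hqp : q ≠ p := fun h => hpq h.symm
        simp only [insta, if_neg hpq, run, Function.update_of_ne hqp, ihx σ hσ, ihy σ hσ]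

/-- All actions of the thread are allowed in splitting instruction sequences. -/
def Allowed : Thread → Prop
  | terminated => True
  | dead => True
  | tau x => Allowed x
  | pcc x a y => AllowedBasic a ∧ Allowed x ∧ Allowed y

theorem Allowed.insta {x : Thread} (hx : x.Allowed) (p : ℕ) (v : Bool) :
    (x.insta p v).Allowed := by
  induction x with
  | terminated => trivial
  | dead => trivial
  | tau x ih => exact ih hx
  | pcc x a y ihx ihy =>
    obtain ⟨ha, hx, hy⟩ := hx
    cases a with
    | act f m => exact ⟨ha, ihx hx, ihy hy⟩
    | split q =>
      simp only [Thread.insta]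
      split
      · trivial
      · exact ⟨trivial, ihx hx, ihy hy⟩
    | reply q =>
      simp only [Thread.insta]
      split
      · cases v
        · exact ihy hy
        · exact ihx hx
      · exact ⟨trivial, ihx hx, ihy hy⟩

theorem allowed_extract (X : List Prim) (hX : ∀ u ∈ X, AllowedPrim u) : (extract X).Allowed := by
  induction X using extract.induct with
  | case1 => simp [extract, Allowed]
  | case2 a x ih =>
    rw [List.forall_mem_cons] at hX
    simpa [extract, Allowed] using ⟨hX.1, ih hX.2⟩
  | case3 a x ih₁ ih₂ =>
    rw [List.forall_mem_cons] at hX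
    simp only [extract, Allowed]
    exact ⟨hX.1, ih₁ hX.2, ih₂ fun u hu => hX.2 u (List.mem_of_mem_drop hu)⟩
  | case4 a x ih₁ ih₂ =>
    rw [List.forall_mem_cons] at hX
    simp only [extract, Allowed]
    exact ⟨hX.1, ih₁ fun u hu => hX.2 u (List.mem_of_mem_drop hu), ih₂ hX.2⟩
  | case5 => simp [extract, Allowed]
  | case6 l x ih =>
    rw [List.forall_mem_cons] at hX
    simp only [extract]
    exact ih fun u hu => hX.2 u (List.mem_of_mem_drop hu)
  | case7 => simp [extract, Allowed]

/-! ### The result of processing a thread by the registers -/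

/-- The use of input registers `inp i`, for `i` in a list, by a thread. -/
def useList {n : ℕ} (b : Fin n → Bool) (l : List (Fin n)) (x : Thread) : Thread :=
  l.foldl (fun y (i : Fin n) => use (.inp i) y (BR (some (b i)))) x

section useList

variable {n : ℕ} (b : Fin n → Bool) (l : List (Fin n))

theorem useList_terminated : useList b l terminated = terminated := by
  induction l with
  | nil => rfl
  | cons i l ih => exact ih

theorem useList_dead : useList b l dead = dead := by
  induction l with
  | nil => rfl
  | cons i l ih => exact ih

theorem useList_tau (x : Thread) : useList b l (tau x) = tau (useList b l x) := by
  induction l generalizing x with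
  | nil => rfl
  | cons i l ih => exact ih _

theorem useList_out (m : Method) (x y : Thread) :
    useList b l (pcc x (.act .out m) y) = pcc (useList b l x) (.act .out m) (useList b l y) := by
  induction l generalizing x y with
  | nil => rfl
  | cons i l ih => exact ih _ _

theorem useList_split (p : ℕ) (x y : Thread) :
    useList b l (pcc x (.split p) y) = pcc (useList b l x) (.split p) (useList b l y) := by
  induction l generalizing x y with
  | nil => rfl
  | cons i l ih => exact ih _ _

theorem useList_reply (p : ℕ) (x y : Thread) :
    useList b l (pcc x (.reply p) y) = pcc (useList b l x) (.reply p) (useList b l y) := by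
  induction l generalizing x y with
  | nil => rfl
  | cons i l ih => exact ih _ _

theorem useList_get_of_notMem (j : ℕ) (hj : ∀ i ∈ l, (i : ℕ) ≠ j) (x y : Thread) :
    useList b l (pcc x (.act (.inp j) .get) y) =
      pcc (useList b l x) (.act (.inp j) .get) (useList b l y) := by
  induction l generalizing x y with
  | nil => rfl
  | cons i l ih =>
    rw [List.forall_mem_cons] at hj
    have h : Focus.inp j ≠ Focus.inp i := fun h => hj.1 (Focus.inp.inj h).symm
    simpa [useList, use, h] using ih hj.2 _ _

theorem useList_get_of_mem (i : Fin n) (hi : i ∈ l) (x y : Thread) :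
    useList b l (pcc x (.act (.inp i) .get) y) = tau (useList b l (cond (b i) x y)) := by
  induction l generalizing x y with
  | nil => simp at hi
  | cons j l ih =>
    by_cases hij : i = j
    · subst hij
      -- reading a register leaves it as it is
      have hd : (BR (some (b i))).derive .get = BR (some (b i)) := rfl
      have hr : (BR (some (b i))).reply .get = some (b i) := rfl
      rw [← useList_tau]
      cases hb : b i <;> rw [hb] at hd hr <;> simp [useList, use, hr, hd, hb]
    · have h : Focus.inp (i : ℕ) ≠ Focus.inp j := fun h => hij (Fin.ext (Focus.inp.inj h))
      have hi' : i ∈ l := by simpa [hij] using hi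
      have := ih hi' (use (.inp j) x (BR (some (b j)))) (use (.inp j) y (BR (some (b j))))
      simp only [useList, List.foldl_cons, use, if_neg h] at this ⊢
      rw [this]
      cases b i <;> rfl

end useList

/-- The service into which the output register with contents `s` is turned by a thread that
uses the input registers with contents `b`. -/
def outcome {n : ℕ} (b : Fin n → Bool) (s : Bool) (x : Thread) : Service :=
  (x.useInputs b).apply .out (BR (some s))

/-- The contents of the input registers numbered by `ℕ`, where those from `n` on do not exist. -/
def inputs {n : ℕ} (b : Fin n → Bool) (i : ℕ) : Option Bool :=
  if h : i < n then some (b ⟨i, h⟩) else none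

section outcome

variable {n : ℕ} (b : Fin n → Bool) (s : Bool)

theorem outcome_eq (x : Thread) :
    outcome b s x = (useList b (List.finRange n) x).apply .out (BR (some s)) := rfl

theorem outcome_terminated : outcome b s terminated = BR (some s) := by
  rw [outcome_eq, useList_terminated]; rfl

theorem outcome_dead : outcome b s dead = BR none := by
  rw [outcome_eq, useList_dead]; rfl

theorem outcome_tau (x : Thread) : outcome b s (tau x) = outcome b s x := by
  rw [outcome_eq, useList_tau]; rfl

theorem outcome_set (x y : Thread) :
    outcome b s (pcc x (.act .out (.set true)) y) = outcome b true x := by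
  rw [outcome_eq, useList_out]; rfl

theorem outcome_get (i : ℕ) (x y : Thread) :
    outcome b s (pcc x (.act (.inp i) .get) y) =
      match inputs b i with
      | none => BR none
      | some v => outcome b s (cond v x y) := by
  rw [outcome_eq]
  by_cases h : i < n
  · rw [useList_get_of_mem b _ ⟨i, h⟩ (List.mem_finRange _)]
    simp only [inputs, dif_pos h]
    rfl
  · rw [useList_get_of_notMem _ _ _ fun j _ hj => h (by omega)]
    simp only [inputs, dif_neg h]
    rfl

/-- A thread without termination always turns the output register into the divergent service. -/
theorem outcome_std {x : Thread} (hx : x.Allowed) : outcome b s x.std = BR none := by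
  induction x generalizing s with
  | terminated => exact outcome_dead b s
  | dead => exact outcome_dead b s
  | tau x ih => exact (outcome_tau b s _).trans (ih s hx)
  | pcc x a y ihx ihy =>
    obtain ⟨ha, hx, hy⟩ := hx
    match a, ha with
    | .act (.inp i) .get, _ =>
      rw [std, outcome_get]
      split
      · rfl
      · rename_i v _
        cases v
        · exact ihy s hy
        · exact ihx s hx
    | .act .out (.set true), _ => exact (outcome_set b s _ _).trans (ihx true hx)
    | .split p, _ => rw [std, outcome_eq, useList_split]; rfl
    | .reply p, _ => rw [std, outcome_eq, useList_reply]; rfl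

end outcome

/-- The joint outcome of a list of threads, when the output register has contents `s`. -/
def joint (β : ℕ → Option Bool) (s : Bool) (α : List Thread) : Option Bool :=
  α.foldr (fun x r => Option.map₂ or (run β (fun _ => none) x) r) (some s)

section joint

variable (β : ℕ → Option Bool) (s : Bool)

theorem map₂_or_left_comm (x y z : Option Bool) :
    Option.map₂ or x (Option.map₂ or y z) = Option.map₂ or y (Option.map₂ or x z) := by
  cases x <;> cases y <;> cases z <;> simp [Bool.or_left_comm]

theorem joint_cons (x : Thread) (α : List Thread) :
    joint β s (x :: α) = Option.map₂ or (run β (fun _ => none) x) (joint β s α) := rfl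

theorem joint_append_singleton (α : List Thread) (x : Thread) :
    joint β s (α ++ [x]) = joint β s (x :: α) := by
  induction α with
  | nil => rfl
  | cons y α ih =>
    rw [List.cons_append, joint_cons, ih, joint_cons, joint_cons, joint_cons, map₂_or_left_comm]

theorem map₂_or_const (x : Option Bool) (α : List Thread) :
    Option.map₂ or (x.map fun _ => true) (joint β s α) = Option.map₂ or x (joint β true α) := by
  induction α with
  | nil => cases x <;> simp [joint]
  | cons y α ih =>
    rw [joint_cons, joint_cons, map₂_or_left_comm, ih, map₂_or_left_comm]

end joint

theorem Allowed.std {x : Thread} (hx : x.Allowed) : x.std.Allowed := by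
  induction x with
  | terminated => trivial
  | dead => trivial
  | tau x ih => exact ih hx
  | pcc x a y ihx ihy => exact ⟨hx.1, ihx hx.2.1, ihy hx.2.2⟩

theorem allowed_csi (α : List Thread) (hα : ∀ x ∈ α, x.Allowed) : (csi α).Allowed := by
  induction α using csi.induct with
  | case1 => rw [csi]; trivial
  | case2 α ih =>
    rw [csi]; exact ih (List.forall_mem_cons.1 hα).2
  | case3 α ih =>
    rw [csi]; exact (ih (List.forall_mem_cons.1 hα).2).std
  | case4 x α ih =>
    rw [List.forall_mem_cons] at hα
    rw [csi]; exact ih (List.forall_mem_append.2 ⟨hα.2, List.forall_mem_singleton.2 hα.1⟩)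
  | case5 x f m y α ihx ihy =>
    obtain ⟨⟨ha, hx, hy⟩, hα⟩ := List.forall_mem_cons.1 hα
    rw [csi]
    exact ⟨ha, ihx (List.forall_mem_append.2 ⟨hα, by simpa using hx⟩),
      ihy (List.forall_mem_append.2 ⟨hα, by simpa using hy⟩)⟩
  | case6 x p y α ih =>
    obtain ⟨⟨_, hx, hy⟩, hα⟩ := List.forall_mem_cons.1 hα
    rw [csi]
    exact ih (List.forall_mem_append.2 ⟨List.forall_mem_append.2
      ⟨hα, by simpa using hx.insta p true⟩, by simpa using hy.insta p false⟩)
  | case7 x p y α ih =>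
    rw [csi]; exact (ih (List.forall_mem_cons.1 hα).2).std

/-- Cyclic interleaving does not matter for the outcome: each thread acts on the output register
only by setting it, so that the joint outcome does not depend on the order of the steps. -/
theorem outcome_csi {n : ℕ} (b : Fin n → Bool) (s : Bool) (α : List Thread)
    (hα : ∀ x ∈ α, x.Allowed) : outcome b s (csi α) = BR (joint (inputs b) s α) := by
  induction α using csi.induct generalizing s with
  | case1 => rw [csi]; exact outcome_terminated b s
  | case2 α ih =>
    rw [csi, ih s (List.forall_mem_cons.1 hα).2, joint_cons]
    cases joint (inputs b) s α <;> simp [run]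
  | case3 α ih =>
    rw [csi, outcome_std b s (allowed_csi α (List.forall_mem_cons.1 hα).2), joint_cons]
    simp [run]
  | case4 x α ih =>
    rw [List.forall_mem_cons] at hα
    rw [csi, outcome_tau, ih s (List.forall_mem_append.2 ⟨hα.2, List.forall_mem_singleton.2 hα.1⟩),
      joint_append_singleton]
    rfl
  | case5 x f m y α ihx ihy =>
    obtain ⟨⟨ha, hx, hy⟩, hα⟩ := List.forall_mem_cons.1 hα
    have hαx := List.forall_mem_append.2 ⟨hα, List.forall_mem_singleton.2 hx⟩
    have hαy := List.forall_mem_append.2 ⟨hα, List.forall_mem_singleton.2 hy⟩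
    rw [csi]
    match f, m, ha with
    | .inp i, .get, _ =>
      rw [outcome_get, joint_cons, run]
      cases inputs b i with
      | none => simp
      | some v =>
        cases v
        · exact (ihy s hαy).trans (by rw [joint_append_singleton]; rfl)
        · exact (ihx s hαx).trans (by rw [joint_append_singleton]; rfl)
    | .out, .set true, _ =>
      rw [outcome_set, ihx true hαx, joint_append_singleton, joint_cons, joint_cons, run,
        map₂_or_const]
  | case6 x p y α ih =>
    obtain ⟨⟨_, hx, hy⟩, hα⟩ := List.forall_mem_cons.1 hα
    rw [csi, outcome_tau, ih s (List.forall_mem_append.2 ⟨List.forall_mem_append.2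
      ⟨hα, by simpa using hx.insta p true⟩, by simpa using hy.insta p false⟩),
      joint_append_singleton, joint_cons, joint_append_singleton, joint_cons, joint_cons, run,
      if_pos rfl, run_insta _ _ _ _ _ rfl, run_insta _ _ _ _ _ rfl, map₂_or_left_comm,
      Option.map₂_assoc Bool.or_assoc]
  | case7 x p y α ih =>
    rw [csi, outcome_std b s (allowed_csi α (List.forall_mem_cons.1 hα).2), joint_cons]
    simp [run]

end Thread

theorem BR_injective : Function.Injective BR := by
  intro s t h
  injection h with _ _ _ h

/-- Splitting computation in terms of the outcome of running the extracted thread. -/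
theorem splittingComputes_iff {n : ℕ} {X : List Prim} (hX : ∀ u ∈ X, AllowedPrim u)
    (f : (Fin n → Bool) → Bool) :
    SplittingComputes X f ↔
      ∀ b, (extract X).run (Thread.inputs b) (fun _ => none) = some (f b) := by
  refine forall_congr' fun b => ?_
  have h := Thread.outcome_csi b false [extract X]
    (List.forall_mem_singleton.2 (Thread.allowed_extract X hX))
  have hj : Thread.joint (Thread.inputs b) false [extract X] =
      (extract X).run (Thread.inputs b) (fun _ => none) := by
    simp only [Thread.joint, List.foldr_cons, List.foldr_nil]
    cases (extract X).run (Thread.inputs b) (fun _ => none) <;> simp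
  rw [hj] at h
  exact ⟨fun hb => BR_injective (h.symm.trans hb), fun hb => h.trans (congrArg BR hb)⟩

/-! ### Single computation paths -/

namespace Thread

/-- Whether the output register is set on the path that is determined by the contents `b` of the
input registers and the assignment `c` of values to parameters. Split instructions are resolved by
`c`; deadlock is not distinguished from termination. -/
def path (b c : ℕ → Bool) : Thread → Bool
  | terminated => false
  | dead => false
  | tau x => path b c x
  | pcc x (.act f _) y =>
      match f with
      | .inp i => cond (b i) (path b c x) (path b c y)
      | .out => true
      | .aux _ => false
  | pcc x (.split p) y => cond (c p) (path b c x) (path b c y)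
  | pcc x (.reply p) y => cond (c p) (path b c x) (path b c y)

/-- In the absence of deadlock, the output register is set if and only if it is set on the path for
some assignment: on every path a parameter is split at most once, so that each combination of
choices on a path comes from an assignment. -/
theorem run_eq_some {β σ : ℕ → Option Bool} {b : ℕ → Bool} (hb : ∀ i v, β i = some v → b i = v)
    {x : Thread} {v : Bool} (hx : x.run β σ = some v) :
    v = true ↔ ∃ c : ℕ → Bool, (∀ p w, σ p = some w → c p = w) ∧ x.path b c = true := by
  induction x generalizing σ v with
  | terminated =>
    simp only [run, Option.some.injEq] at hx
    simp [path, ← hx]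
  | dead => simp [run] at hx
  | tau x ih => exact ih hx
  | pcc x a y ihx ihy =>
    match a with
    | .act (.inp i) .get =>
      simp only [run, Option.bind_eq_some_iff] at hx
      obtain ⟨w, hw, hx⟩ := hx
      simp only [path, hb i w hw]
      cases w
      · exact ihy hx
      · exact ihx hx
    | .act .out (.set true) =>
      simp only [run, Option.map_eq_some_iff] at hx
      obtain ⟨w, -, rfl⟩ := hx
      simp only [path, and_true, true_iff]
      exact ⟨fun p => (σ p).getD false, fun p w h => by simp [h]⟩
    | .act (.inp i) (.set _) => simp [run] at hx
    | .act (.aux i) m => simp [run] at hx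
    | .act .out .get => simp [run] at hx
    | .act .out (.set false) => simp [run] at hx
    | .split p =>
      simp only [run, Option.ite_none_right_eq_some, Option.map₂_eq_some_iff] at hx
      obtain ⟨hp, v₁, v₂, h₁, h₂, rfl⟩ := hx
      have ext (c : ℕ → Bool) (w : Bool) :
          (∀ q u, Function.update σ p (some w) q = some u → c q = u) ↔
          (∀ q u, σ q = some u → c q = u) ∧ c p = w := by
        constructor
        · intro h
          refine ⟨fun q u hq => h q u ?_, h p w (by simp)⟩
          rw [Function.update_of_ne (by rintro rfl; simp [hp] at hq), hq]
        · rintro ⟨h, hpw⟩ q u hq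
          by_cases hqp : q = p
          · subst hqp; simpa [hpw] using hq
          · rw [Function.update_of_ne hqp] at hq; exact h q u hq
      rw [Bool.or_eq_true, ihx h₁, ihy h₂, ← exists_or]
      refine exists_congr fun c => ?_
      rw [ext, ext, path]
      cases c p <;> simp
    | .reply p =>
      simp only [run, Option.bind_eq_some_iff] at hx
      obtain ⟨w, hw, hx⟩ := hx
      have key : ∀ c : ℕ → Bool,
          (∀ q u, σ q = some u → c q = u) ∧ (pcc x (.reply p) y).path b c = true ↔
            (∀ q u, σ q = some u → c q = u) ∧ (cond w x y).path b c = true := by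
        intro c
        refine and_congr_right fun hc => ?_
        rw [path, hc p w hw]
        cases w <;> rfl
      simp only [key]
      cases w
      · exact ihy hx
      · exact ihx hx

end Thread

/-! ### Boolean functions realized by the nodes of a circuit -/

/-- The functions in `S` are all computed by nodes (inputs or gates) of a single sequence of at most
`k` gates. Keeping track of whole sets of functions allows values to be shared. -/
def Realizable (n k : ℕ) (S : Set ((Fin n → Bool) → Bool)) : Prop :=
  ∃ j ≤ k, ∃ C : Gates n j, ∀ f ∈ S, ∃ u : Fin n ⊕ Fin j, ∀ x, Sum.elim x (C.eval x) u = f x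

namespace Realizable

variable {n k : ℕ} {S T : Set ((Fin n → Bool) → Bool)}

theorem mono (h : Realizable n k S) {l : ℕ} (hkl : k ≤ l) (hTS : T ⊆ S) : Realizable n l T := by
  obtain ⟨j, hj, C, hC⟩ := h
  exact ⟨j, hj.trans hkl, C, fun f hf => hC f (hTS hf)⟩

theorem projections (n : ℕ) :
    Realizable n 0 (Set.range fun (i : Fin n) (x : Fin n → Bool) => x i) := by
  refine ⟨0, le_rfl, .nil, ?_⟩
  rintro _ ⟨i, rfl⟩
  exact ⟨.inl i, fun x => rfl⟩

/-- A gate whose predecessors compute functions in `S` can be added. -/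
theorem insert_gate (h : Realizable n k S) (f : (Fin n → Bool) → Bool)
    (hf : ∀ {j : ℕ} (C : Gates n j),
      (∀ g ∈ S, ∃ u : Fin n ⊕ Fin j, ∀ x, Sum.elim x (C.eval x) u = g x) →
        ∃ G : Gate n j, ∀ x, G.eval x (C.eval x) = f x) :
    Realizable n (k + 1) (insert f S) := by
  obtain ⟨j, hj, C, hC⟩ := h
  obtain ⟨G, hG⟩ := hf C hC
  refine ⟨j + 1, by omega, .snoc C G, ?_⟩
  rintro g (rfl | hg)
  · exact ⟨.inr (Fin.last j), fun x => by simp [Gates.eval, hG]⟩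
  · obtain ⟨u, hu⟩ := hC g hg
    refine ⟨u.map id Fin.castSucc, fun x => ?_⟩
    rw [← hu x]
    cases u <;> simp [Gates.eval]

theorem insert_const (h : Realizable n k S) (b : Bool) :
    Realizable n (k + 1) (insert (fun _ => b) S) :=
  h.insert_gate _ fun _ _ => ⟨.const b, fun _ => rfl⟩

theorem insert_not (h : Realizable n k S) {f : (Fin n → Bool) → Bool} (hf : f ∈ S) :
    Realizable n (k + 1) (insert (fun x => !(f x)) S) := by
  refine h.insert_gate _ fun C hC => ?_
  obtain ⟨u, hu⟩ := hC f hf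
  exact ⟨.not u, fun x => by simp [Gate.eval, hu]⟩

theorem insert_and (h : Realizable n k S) {f g : (Fin n → Bool) → Bool} (hf : f ∈ S)
    (hg : g ∈ S) : Realizable n (k + 1) (insert (fun x => f x && g x) S) := by
  refine h.insert_gate _ fun C hC => ?_
  obtain ⟨u, hu⟩ := hC f hf
  obtain ⟨v, hv⟩ := hC g hg
  exact ⟨.and u v, fun x => by simp [Gate.eval, hu, hv]⟩

theorem insert_or (h : Realizable n k S) {f g : (Fin n → Bool) → Bool} (hf : f ∈ S)
    (hg : g ∈ S) : Realizable n (k + 1) (insert (fun x => f x || g x) S) := by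
  refine h.insert_gate _ fun C hC => ?_
  obtain ⟨u, hu⟩ := hC f hf
  obtain ⟨v, hv⟩ := hC g hg
  exact ⟨.or u v, fun x => by simp [Gate.eval, hu, hv]⟩

theorem insert_cond (h : Realizable n k S) {s f g : (Fin n → Bool) → Bool} (hs : s ∈ S)
    (hf : f ∈ S) (hg : g ∈ S) :
    Realizable n (k + 4) (insert (fun x => cond (s x) (f x) (g x)) S) := by
  have h₁ := h.insert_and hs hf
  have h₂ := h₁.insert_not (Set.mem_insert_of_mem _ hs)
  have h₃ := h₂.insert_and (Set.mem_insert _ _)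
    (Set.mem_insert_of_mem _ (Set.mem_insert_of_mem _ hg))
  have h₄ := h₃.insert_or (Set.mem_insert_of_mem _ (Set.mem_insert_of_mem _ (Set.mem_insert _ _)))
    (Set.mem_insert _ _)
  refine h₄.mono le_rfl ?_
  rintro q (rfl | hq)
  · left
    funext x
    cases s x <;> simp
  · simp [hq]

/-- The test that the values of `f` and `g` are equal. -/
theorem insert_beq (h : Realizable n k S) {f g : (Fin n → Bool) → Bool} (hf : f ∈ S)
    (hg : g ∈ S) : Realizable n (k + 5) (insert (fun x => f x == g x) S) := by
  refine ((h.insert_not hg).insert_cond (Set.mem_insert_of_mem _ hf)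
    (Set.mem_insert_of_mem _ hg) (Set.mem_insert _ _)).mono le_rfl ?_
  rintro q (rfl | hq)
  · left
    funext x
    cases f x <;> cases g x <;> rfl
  · simp [hq]

/-- The test that two bit vectors of length `N` are equal. -/
theorem insert_forall_eq (h : Realizable n k S) {f g : ℕ → (Fin n → Bool) → Bool} (N : ℕ)
    (hf : ∀ i < N, f i ∈ S) (hg : ∀ i < N, g i ∈ S) :
    Realizable n (k + 6 * N + 1) (insert (fun x => decide (∀ i < N, f i x = g i x)) S) := by
  induction N with
  | zero => simpa using h.insert_const true
  | succ N ih =>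
    have h₁ := ih (fun i hi => hf i (by omega)) (fun i hi => hg i (by omega))
    have h₂ := h₁.insert_beq (Set.mem_insert_of_mem _ (hf N (by omega)))
      (Set.mem_insert_of_mem _ (hg N (by omega)))
    have h₃ := h₂.insert_and (Set.mem_insert _ _) (Set.mem_insert_of_mem _ (Set.mem_insert _ _))
    refine h₃.mono (by omega) ?_
    rintro q (rfl | hq)
    · left
      funext x
      rw [Bool.eq_iff_iff]
      simp only [Nat.forall_lt_succ_right, decide_eq_true_eq, Bool.and_eq_true, beq_iff_eq]
      exact and_comm
    · simp [hq]

theorem exists_circuit (h : Realizable n k S) {f : (Fin n → Bool) → Bool} (hf : f ∈ S) :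
    ∃ C : Circuit n, (∀ x, C.eval x = f x) ∧ C.size ≤ n + k := by
  obtain ⟨j, hj, C, hC⟩ := h
  obtain ⟨u, hu⟩ := hC f hf
  exact ⟨⟨j, C, u⟩, hu, Nat.add_le_add_left hj n⟩

/-- The path determined by an instruction sequence is followed backwards: the value for a suffix
of the sequence is selected from the values for shorter suffixes. -/
theorem insert_path (h : Realizable n k S) (b c : ℕ → (Fin n → Bool) → Bool)
    (hb : ∀ i, b i ∈ S) (hc : ∀ p, c p ∈ S) (X : List Prim) :
    Realizable n (k + 4 * X.length + 1)
      (S ∪ Set.range fun (j : ℕ) x => (extract (X.drop j)).path (b · x) (c · x)) := by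
  induction X with
  | nil =>
    refine (h.insert_const false).mono (by simp) ?_
    rintro f (hf | ⟨j, rfl⟩)
    · exact Or.inr hf
    · left
      simp [extract, Thread.path]
  | cons u X ih =>
    set S' := S ∪ Set.range fun (j : ℕ) x => (extract (X.drop j)).path (b · x) (c · x) with hS'
    set f : (Fin n → Bool) → Bool := fun x => (extract (u :: X)).path (b · x) (c · x) with hf
    have mem (j : ℕ) : (fun x => (extract (X.drop j)).path (b · x) (c · x)) ∈ S' :=
      Or.inr ⟨j, rfl⟩
    have mem₀ : (fun x => (extract X).path (b · x) (c · x)) ∈ S' := mem 0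
    suffices hu : Realizable n (k + 4 * X.length + 1 + 4) (insert f S') by
      refine hu.mono (by simp; omega) ?_
      rintro g (hg | ⟨_ | j, rfl⟩)
      · exact Or.inr (Or.inl hg)
      · exact Or.inl rfl
      · exact Or.inr (mem j)
    -- the reply to a basic instruction selects one of two values that are already available
    have test (a : Basic) {g₁ g₂ : Thread} (h₁ : (fun x => g₁.path (b · x) (c · x)) ∈ S')
        (h₂ : (fun x => g₂.path (b · x) (c · x)) ∈ S') :
        Realizable n (k + 4 * X.length + 1 + 4)
          (insert (fun x => (Thread.pcc g₁ a g₂).path (b · x) (c · x)) S') := by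
      match a with
      | .act (.inp i) m => exact ih.insert_cond (Or.inl (hb i)) h₁ h₂
      | .act (.aux i) m => exact (ih.insert_const false).mono (by omega) subset_rfl
      | .act .out m => exact (ih.insert_const true).mono (by omega) subset_rfl
      | .split p => exact ih.insert_cond (Or.inl (hc p)) h₁ h₂
      | .reply p => exact ih.insert_cond (Or.inl (hc p)) h₁ h₂
    match u with
    | .plain a => simpa only [hf, extract] using test a mem₀ mem₀
    | .ptst a => simpa only [hf, extract] using test a mem₀ (mem 1)
    | .ntst a => simpa only [hf, extract] using test a (mem 1) mem₀
    | .jmp 0 =>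
      simpa only [hf, extract, Thread.path] using
        (ih.insert_const false).mono (by omega) subset_rfl
    | .jmp (l + 1) =>
      refine ih.mono (by omega) (Set.insert_subset ?_ subset_rfl)
      simpa only [hf, extract] using mem l
    | .halt =>
      simpa only [hf, extract, Thread.path] using
        (ih.insert_const false).mono (by omega) subset_rfl

end Realizable

/-! ### Encoded pairs of strings -/

/-- The bit at position `t` of the encoding of a pair of strings, the first of which has length
`n`, in terms of the bits `b i` and `c j` of these strings. -/
def codeAt (n : ℕ) (b c : ℕ → Bool) (t : ℕ) : Bool :=
  if t < 2 * n then b (t / 2) else if t = 2 * n then false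
  else if t = 2 * n + 1 then true else c (t - (2 * n + 2))

theorem pairCode_nil (c : List Bool) : pairCode [] c = false :: true :: c := rfl

theorem pairCode_cons (a : Bool) (w c : List Bool) :
    pairCode (a :: w) c = a :: a :: pairCode w c := rfl

theorem length_pairCode (w c : List Bool) :
    (pairCode w c).length = 2 * w.length + 2 + c.length := by
  induction w with
  | nil => simp [pairCode_nil]; omega
  | cons a w ih => simp [pairCode_cons, ih]; omega

theorem pairCode_injective {w w' c c' : List Bool} (h : pairCode w c = pairCode w' c') :
    w = w' ∧ c = c' := by
  induction w generalizing w' with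
  | nil =>
    cases w' with
    | nil => simpa [pairCode_nil] using h
    | cons a' w' =>
      simp only [pairCode_nil, pairCode_cons, List.cons.injEq] at h
      exact absurd (h.1.trans h.2.1.symm) Bool.false_ne_true
  | cons a w ih =>
    cases w' with
    | nil =>
      simp only [pairCode_nil, pairCode_cons, List.cons.injEq] at h
      exact absurd (h.1.symm.trans h.2.1) Bool.false_ne_true
    | cons a' w' =>
      simp only [pairCode_cons, List.cons.injEq] at h
      obtain ⟨rfl, -, h⟩ := h
      obtain ⟨rfl, rfl⟩ := ih h
      exact ⟨rfl, rfl⟩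

theorem pairCode_map_range (n L : ℕ) (b c : ℕ → Bool) :
    pairCode ((List.range n).map b) ((List.range L).map c) =
      (List.range (2 * n + 2 + L)).map (codeAt n b c) := by
  induction n generalizing b with
  | zero =>
    have h : 2 * 0 + 2 + L = L + 1 + 1 := by omega
    rw [h, List.range_succ_eq_map, List.range_succ_eq_map]
    simp [pairCode_nil, codeAt, Function.comp_def]
  | succ n ih =>
    have h : 2 * (n + 1) + 2 + L = 2 * n + 2 + L + 1 + 1 := by omega
    rw [h, List.range_succ_eq_map, List.map_cons, List.map_map, pairCode_cons, ih,
      List.range_succ_eq_map, List.range_succ_eq_map]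
    simp only [List.map_cons, List.map_map, List.cons.injEq]
    refine ⟨by simp [codeAt], ?_,  List.map_congr_left fun t _ => ?_⟩
    · rw [codeAt, if_pos (by omega)]
    have h₁ : (t + 2) / 2 = t / 2 + 1 := by omega
    have h₂ : t + 2 - (2 * (n + 1) + 2) = t - (2 * n + 2) := by omega
    simp only [codeAt, Function.comp, Nat.succ_eq_add_one, add_assoc, Nat.reduceAdd, h₁, h₂]
    split_ifs <;> first | rfl | omega

theorem ofFn_eq_map_range {α : Type*} (n : ℕ) (f : ℕ → α) :
    List.ofFn (fun i : Fin n => f i) = (List.range n).map f := by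
  apply List.ext_getElem <;> simp

theorem exists_eq_map_range (w : List Bool) : ∃ b : ℕ → Bool, w = (List.range w.length).map b :=
  ⟨fun i => w.getD i false, by apply List.ext_getElem <;> simp +contextual⟩

theorem map_range_inj {α : Type*} {n : ℕ} {f g : ℕ → α} :
    (List.range n).map f = (List.range n).map g ↔ ∀ i < n, f i = g i := by
  simp

theorem exists_fin_eq {α : Type*} [Inhabited α] {n : ℕ} (x : Fin n → α) :
    ∃ y : ℕ → α, x = fun i : Fin n => y i :=
  ⟨fun i => if h : i < n then x ⟨i, h⟩ else default, by ext i; simp⟩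

theorem codeAt_eq_iff {n L : ℕ} {b c y : ℕ → Bool} :
    (∀ t < 2 * n + 2 + L, y t = codeAt n b c t) ↔
      (∀ i < n, y (2 * i) = b i ∧ y (2 * i + 1) = b i) ∧ y (2 * n) = false ∧
        y (2 * n + 1) = true ∧ ∀ j < L, y (2 * n + 2 + j) = c j := by
  constructor
  · intro h
    refine ⟨fun i hi => ⟨?_, ?_⟩, ?_, ?_, fun j hj => ?_⟩
    · rw [h _ (by omega), codeAt, if_pos (by omega)]
      congr 1; omega
    · rw [h _ (by omega), codeAt, if_pos (by omega)]
      congr 1; omega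
    · rw [h _ (by omega)]; simp [codeAt]
    · rw [h _ (by omega)]; simp [codeAt]
    · rw [h _ (by omega), codeAt, if_neg (by omega), if_neg (by omega), if_neg (by omega)]
      congr 1; omega
  · rintro ⟨h₁, h₂, h₃, h₄⟩ t ht
    rw [codeAt]
    split_ifs with h h' h'
    · obtain h' | h' := Nat.mod_two_eq_zero_or_one t
      · rw [← (h₁ (t / 2) (by omega)).1]; congr 1; omega
      · rw [← (h₁ (t / 2) (by omega)).2]; congr 1; omega
    · rw [h', h₂]
    · rw [h', h₃]
    · rw [← h₄ _ (by omega)]; congr 1; omega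

/-! ### Polynomial bounds -/

theorem eval_mono (h : Polynomial ℕ) : Monotone fun n : ℕ => h.eval n := by
  intro m n hmn
  simp only [Polynomial.eval_eq_sum_range]
  exact Finset.sum_le_sum fun i _ => Nat.mul_le_mul_left _ (Nat.pow_le_pow_left hmn i)

/-- From 2 on a polynomial is bounded by a power. -/
theorem exists_eval_le_pow (h : Polynomial ℕ) : ∃ k : ℕ, ∀ n, 2 ≤ n → h.eval n ≤ n ^ k := by
  induction h using Polynomial.induction_on' with
  | add p q hp hq =>
    obtain ⟨k, hk⟩ := hp
    obtain ⟨l, hl⟩ := hq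
    refine ⟨max k l + 1, fun n hn => ?_⟩
    have h₁ := (hk n hn).trans (Nat.pow_le_pow_right (by omega) (le_max_left k l))
    have h₂ := (hl n hn).trans (Nat.pow_le_pow_right (by omega) (le_max_right k l))
    rw [Polynomial.eval_add, pow_succ]
    nlinarith
  | monomial j a =>
    refine ⟨a + j, fun n hn => ?_⟩
    rw [Polynomial.eval_monomial, pow_add]
    exact Nat.mul_le_mul_right _
      (Nat.lt_two_pow_self.le.trans (Nat.pow_le_pow_left hn a))

/-! ### Verifiers with certificates of a fixed length -/

/-- The function `f` has a verifier `D` for certificates of length `L` that can be added to a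
circuit, whichever nodes provide its arguments, at the cost of `K` gates. The bits of arguments and
certificates are numbered by `ℕ`; only the first `n` and `L` of them matter. -/
def Verifiable (n L K : ℕ) (f : (Fin n → Bool) → Bool) : Prop :=
  ∃ D : (ℕ → Bool) → (ℕ → Bool) → Bool,
    (∀ b b' c c', (∀ i < n, b i = b' i) → (∀ j < L, c j = c' j) → D b c = D b' c') ∧
    (∀ b, f (fun i => b i) = true ↔ ∃ c, D b c = true) ∧
    ∀ (m k : ℕ) (S : Set ((Fin m → Bool) → Bool)) (b c : ℕ → (Fin m → Bool) → Bool),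
      (∀ i, b i ∈ S) → (∀ j, c j ∈ S) → Realizable m k S →
        Realizable m (k + K) (insert (fun x => D (b · x) (c · x)) S)

/-- The parameter of a primitive instruction, if any. -/
def Prim.param? : Prim → Option ℕ
  | .plain (.split p) | .ptst (.split p) | .ntst (.split p) => some p
  | .plain (.reply p) | .ptst (.reply p) | .ntst (.reply p) => some p
  | _ => none

theorem path_congr (b : ℕ → Bool) {c c' : ℕ → Bool} (X : List Prim)
    (h : ∀ p ∈ X.filterMap Prim.param?, c p = c' p) :
    (extract X).path b c = (extract X).path b c' := by
  have drop {u : Prim} {x : List Prim} (l : ℕ)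
      (h : ∀ p ∈ (u :: x).filterMap Prim.param?, c p = c' p) :
      ∀ p ∈ (x.drop l).filterMap Prim.param?, c p = c' p := fun p hp =>
    h p ((((List.drop_sublist l x).trans (List.sublist_cons_self u x)).filterMap _).subset hp)
  have atom (a : Basic) {g₁ g₂ : Thread} (h₁ : g₁.path b c = g₁.path b c')
      (h₂ : g₂.path b c = g₂.path b c') (ha : ∀ p, a = .split p ∨ a = .reply p → c p = c' p) :
      (Thread.pcc g₁ a g₂).path b c = (Thread.pcc g₁ a g₂).path b c' := by
    match a with
    | .act (.inp i) m => simp only [Thread.path, h₁, h₂]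
    | .act (.aux i) m => rfl
    | .act .out m => rfl
    | .split p => simp only [Thread.path, h₁, h₂, ha p (Or.inl rfl)]
    | .reply p => simp only [Thread.path, h₁, h₂, ha p (Or.inr rfl)]
  induction X using extract.induct with
  | case1 => simp [extract, Thread.path]
  | case2 a x ih =>
    rw [extract]
    refine atom a (ih (drop 0 h)) (ih (drop 0 h)) fun p hp => h p ?_
    rcases hp with rfl | rfl <;> simp [Prim.param?]
  | case3 a x ih₁ ih₂ =>
    rw [extract]
    refine atom a (ih₁ (drop 0 h)) (ih₂ (drop 1 h)) fun p hp => h p ?_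
    rcases hp with rfl | rfl <;> simp [Prim.param?]
  | case4 a x ih₁ ih₂ =>
    rw [extract]
    refine atom a (ih₁ (drop 1 h)) (ih₂ (drop 0 h)) fun p hp => h p ?_
    rcases hp with rfl | rfl <;> simp [Prim.param?]
  | case5 => simp [extract, Thread.path]
  | case6 l x ih =>
    rw [extract]
    exact ih (drop l h)
  | case7 => simp [extract, Thread.path]

/-- The certificates verified are the combinations of choices at split instructions. -/
theorem verifiable_of_splittingComputes {n L : ℕ} {X : List Prim} {f : (Fin n → Bool) → Bool}
    (hX : ∀ u ∈ X, AllowedPrim u) (hf : SplittingComputes X f) (hL : X.length ≤ L) :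
    Verifiable n L (4 * X.length + 2) f := by
  rw [splittingComputes_iff hX] at hf
  set ps := X.filterMap Prim.param?
  have hlen : ps.length ≤ L := (List.length_filterMap_le _ _).trans hL
  -- the certificate lists the values of the parameters in order of occurrence
  refine ⟨fun b c => (extract X).path (fun i => if i < n then b i else false)
    (fun p => if ps.idxOf p < L then c (ps.idxOf p) else false), ?_, fun b => ?_, ?_⟩
  · intro b b' c c' hb hc
    dsimp only
    congr 1
    · funext i; split_ifs with h
      · exact hb i h
      · rfl
    · funext p; split_ifs with h
      · exact hc _ h
      · rfl
  · rw [Thread.run_eq_some (b := fun i => if i < n then b i else false) ?_ (hf _)]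
    · constructor
      · rintro ⟨c, -, hc⟩
        refine ⟨fun j => c (ps.getD j 0), ?_⟩
        rw [← hc]
        refine path_congr _ X fun p hp => ?_
        have hp' : ps.idxOf p < ps.length := List.idxOf_lt_length_of_mem hp
        simp [hp'.trans_le hlen, hp']
      · rintro ⟨c, hc⟩
        exact ⟨_, fun p w h => by simp at h, hc⟩
    · intro i v h
      by_cases hi : i < n <;> simp [Thread.inputs, hi] at h ⊢
      exact h
  · intro m k S b c hb hc hS
    have h := (hS.insert_const false).insert_path
      (fun i => if i < n then b i else fun _ => false)
      (fun p => if ps.idxOf p < L then c (ps.idxOf p) else fun _ => false)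
      (fun i => by split_ifs <;> simp [hb])
      (fun p => by split_ifs <;> simp [hc]) X
    refine h.mono (by omega) (Set.insert_subset (Or.inr ⟨0, ?_⟩) fun g hg => Or.inl (Or.inr hg))
    funext x
    dsimp only [List.drop_zero]
    congr 1
    · funext i; split_ifs <;> rfl
    · funext p; split_ifs <;> rfl

/-- Functions of at most one bit need no certificates. -/
theorem verifiable_of_le_one {n : ℕ} (hn : n ≤ 1) (f : (Fin n → Bool) → Bool) :
    Verifiable n 0 6 f := by
  refine ⟨fun b _ => f fun i => b i, ?_, fun b => by simp, ?_⟩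
  · intro b b' c c' hb _
    exact congrArg f (funext fun i => hb i i.2)
  · intro m k S b c hb _ hS
    obtain rfl | rfl : n = 0 ∨ n = 1 := by omega
    · refine (hS.insert_const (f Fin.elim0)).mono (by omega) (Set.insert_subset (Or.inl ?_) ?_)
      · funext x; exact congrArg f (Subsingleton.elim _ _)
      · exact Set.subset_insert _ _
    · have h := (hS.insert_const (f fun _ => true)).insert_const (f fun _ => false)
      have h' := h.insert_cond (Or.inr (Or.inr (hb 0))) (Or.inr (Or.inl rfl)) (Or.inl rfl)
      refine h'.mono (by omega) (Set.insert_subset (Or.inl ?_) ?_)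
      swap
      · exact fun g hg => Or.inr (Or.inr (Or.inr hg))
      funext x
      have (v : Bool) (hv : b 0 x = v) : (fun i : Fin 1 => b i x) = fun _ => v := by
        funext i; rw [Fin.fin_one_eq_zero i]; exact hv
      dsimp only
      cases hv : b 0 x
      · rw [this _ hv]; rfl
      · rw [this _ hv]; rfl

/-- If the certificates of a function on strings have a length that is determined by the length
of the string, the checking function can reject all codes with certificates of a different
length. Then the code length determines how a code is to be split, and a single circuit for each
code length does. -/
theorem mem_NPPoly_of_verifiable {F : List Bool → Bool} {L : ℕ → ℕ} {k : ℕ} {K : Polynomial ℕ}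
    (hL : Monotone L) (hLk : ∀ n, L n ≤ n ^ k)
    (hF : ∀ n, Verifiable n (L n) (K.eval n) fun a => F (List.ofFn a)) : F ∈ NPPoly := by
  classical
  choose D hcongr hspec hreal using hF
  have hlen {n n' : ℕ} (h : 2 * n + 2 + L n = 2 * n' + 2 + L n') : n = n' := by
    rcases lt_trichotomy n n' with hlt | heq | hlt
    · have := hL hlt.le; omega
    · exact heq
    · have := hL hlt.le; omega
  let g : List Bool → Bool := fun u => decide (∃ (n : ℕ) (b c : ℕ → Bool),
    u = pairCode ((List.range n).map b) ((List.range (L n)).map c) ∧ D n b c = true)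
  refine ⟨k, g, ?_, ?_⟩
  · refine ⟨7 * Polynomial.X + K + 5, fun m => ?_⟩
    by_cases hm : ∃ n, m = 2 * n + 2 + L n
    · obtain ⟨n, hm⟩ := hm
      have : NeZero m := ⟨by omega⟩
      let y : ℕ → (Fin m → Bool) → Bool := fun t x => x (Fin.ofNat m t)
      have hy (t : ℕ) : y t ∈ Set.range fun (i : Fin m) (x : Fin m → Bool) => x i := ⟨_, rfl⟩
      have h₁ := (Realizable.projections m).insert_forall_eq (f := fun i => y (2 * i))
        (g := fun i => y (2 * i + 1)) n (fun i _ => hy _) (fun i _ => hy _)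
      have h₂ := hreal n m _ _ (fun i => y (2 * i)) (fun j => y (2 * n + 2 + j))
        (fun i => Or.inr (hy _)) (fun j => Or.inr (hy _)) h₁
      have h₃ := h₂.insert_not (Or.inr (Or.inr (hy (2 * n))))
      have h₄ := h₃.insert_and (Or.inl rfl) (Or.inr (Or.inr (Or.inr (hy (2 * n + 1)))))
      have h₅ := h₄.insert_and (Or.inl rfl) (Or.inr (Or.inr (Or.inl rfl)))
      have h₆ := h₅.insert_and (Or.inl rfl) (Or.inr (Or.inr (Or.inr (Or.inr (Or.inl rfl)))))
      obtain ⟨C, hC, hsize⟩ := h₆.exists_circuit (Or.inl rfl)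
      refine ⟨C, fun x => ?_, hsize.trans ?_⟩
      · have hx : List.ofFn x = (List.range (2 * n + 2 + L n)).map (y · x) := by
          rw [← hm, ← ofFn_eq_map_range]
          congr 1
          funext i
          simp [y]
        rw [hC, Bool.eq_iff_iff]
        simp only [g, hx, decide_eq_true_eq, Bool.and_eq_true, Bool.not_eq_true']
        constructor
        · rintro ⟨⟨⟨h₁, h₂⟩, h₃⟩, h₄⟩
          refine ⟨n, _, _, ?_, h₃⟩
          rw [pairCode_map_range, map_range_inj, codeAt_eq_iff]
          exact ⟨fun i hi => ⟨rfl, (h₄ i hi).symm⟩, h₁, h₂, fun j _ => rfl⟩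
        · rintro ⟨n', b, c, h, hD⟩
          have hn : n = n' := hlen (by simpa [length_pairCode] using congrArg List.length h)
          subst hn
          rw [pairCode_map_range, map_range_inj, codeAt_eq_iff] at h
          obtain ⟨h₁, h₂, h₃, h₄⟩ := h
          refine ⟨⟨⟨h₂, h₃⟩, ?_⟩, fun i hi => (h₁ i hi).1.trans (h₁ i hi).2.symm⟩
          rw [← hD]
          exact hcongr n _ _ _ _ (fun i hi => (h₁ i hi).1) h₄
      · have := eval_mono K (show n ≤ m by omega)
        simp only [Polynomial.eval_add, Polynomial.eval_mul, Polynomial.eval_X,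
          Polynomial.eval_ofNat] at this ⊢
        omega
    · obtain ⟨C, hC, hsize⟩ :=
        ((Realizable.projections m).insert_const false).exists_circuit (Or.inl rfl)
      refine ⟨C, fun x => ?_, hsize.trans ?_⟩
      · rw [hC]
        symm
        simp only [g, decide_eq_false_iff_not]
        rintro ⟨n, b, c, h, -⟩
        exact hm ⟨n, by simpa [length_pairCode] using congrArg List.length h⟩
      · simp only [Polynomial.eval_add, Polynomial.eval_mul, Polynomial.eval_X,
          Polynomial.eval_ofNat]
        omega
  · intro w
    obtain ⟨b, hb⟩ := exists_eq_map_range w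
    have hw := hspec w.length b
    dsimp only at hw
    rw [ofFn_eq_map_range, ← hb] at hw
    rw [hw]
    constructor
    · rintro ⟨c, hc⟩
      refine ⟨(List.range (L w.length)).map c, by simpa using hLk _, ?_⟩
      simp only [g, decide_eq_true_eq]
      exact ⟨w.length, b, c, by rw [← hb], hc⟩
    · rintro ⟨c, -, hc⟩
      simp only [g, decide_eq_true_eq] at hc
      obtain ⟨n, b', c', h, hD⟩ := hc
      obtain ⟨h, -⟩ := pairCode_injective h
      have hn : n = w.length := by rw [h]; simp
      subst hn
      replace h := hb.symm.trans h
      rw [map_range_inj] at h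
      refine ⟨c', ?_⟩
      rw [← hD]
      exact hcongr _ _ _ _ _ h fun _ _ => rfl

theorem mem_NPPoly_of_mem_PLSIS {f : BoolFamily} (hf : f ∈ PLSIS) : familyEquiv f ∈ NPPoly := by
  obtain ⟨h, hX⟩ := hf
  choose X hXs hXf hXh using hX
  obtain ⟨k, hk⟩ := exists_eval_le_pow h
  -- `0 ^ k` and `1 ^ k` do not provide certificates of sufficient length
  refine mem_NPPoly_of_verifiable (L := fun n => if n ≤ 1 then 0 else n ^ k) (k := k)
    (K := 4 * h + 6) ?_ ?_ fun n => ?_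
  · intro m n hmn
    beta_reduce
    split_ifs
    · rfl
    · exact Nat.zero_le _
    · omega
    · exact Nat.pow_le_pow_left hmn k
  · intro n
    split_ifs
    · exact Nat.zero_le _
    · rfl
  · have hfn : (fun a => familyEquiv f (List.ofFn a)) = f n :=
      congrFun (familyEquiv.symm_apply_apply f) n
    rw [hfn]
    simp only [Polynomial.eval_add, Polynomial.eval_mul, Polynomial.eval_ofNat]
    have mono {L K K' : ℕ} (hK : K ≤ K') (hV : Verifiable n L K (f n)) :
        Verifiable n L K' (f n) := by
      obtain ⟨D, h₁, h₂, h₃⟩ := hV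
      exact ⟨D, h₁, h₂, fun m k S b c hb hc hS =>
        (h₃ m k S b c hb hc hS).mono (by omega) subset_rfl⟩
    split_ifs with hn
    · exact mono (by omega) (verifiable_of_le_one hn (f n))
    · refine mono ?_ (verifiable_of_splittingComputes (hXs n).2 (hXf n)
        ((hXh n).trans (hk n (by omega))))
      have := hXh n
      omega

/-! ### Propositional formulas as instruction sequences -/

/-- Propositional formulas over input registers and parameters. -/
inductive Form : Type
  | const (v : Bool)
  | inp (i : ℕ)
  | par (p : ℕ)
  | not (φ : Form)
  | and (φ ψ : Form)
  | or (φ ψ : Form)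

namespace Form

/-- The value of a formula for given contents of input registers and values of parameters. -/
def eval (b c : ℕ → Bool) : Form → Bool
  | const v => v
  | inp i => b i
  | par p => c p
  | not φ => !(eval b c φ)
  | and φ ψ => eval b c φ && eval b c ψ
  | or φ ψ => eval b c φ || eval b c ψ

/-- The formula is about the first `n` input registers and the parameters below `M` only. -/
def Bounded (n M : ℕ) : Form → Prop
  | const _ => True
  | inp i => i < n
  | par p => p < M
  | not φ => Bounded n M φ
  | and φ ψ => Bounded n M φ ∧ Bounded n M ψ
  | or φ ψ => Bounded n M φ ∧ Bounded n M ψ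

/-- The equivalence of two formulas. -/
def iff (φ ψ : Form) : Form := or (and φ ψ) (and (not φ) (not ψ))

theorem eval_iff (b c : ℕ → Bool) (φ ψ : Form) :
    (iff φ ψ).eval b c = (φ.eval b c == ψ.eval b c) := by
  simp only [iff, eval]
  cases φ.eval b c <;> cases ψ.eval b c <;> rfl

/-- The disjunction of a list of formulas. -/
def disj (l : List Form) : Form := l.foldr or (const false)

theorem eval_disj (b c : ℕ → Bool) (l : List Form) :
    (disj l).eval b c = true ↔ ∃ φ ∈ l, φ.eval b c = true := by
  induction l with
  | nil => simp [disj, eval]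
  | cons φ l ih =>
    rw [disj, List.foldr_cons, eval, Bool.or_eq_true, ← disj, ih]
    simp

theorem bounded_disj {n M : ℕ} {l : List Form} (hl : ∀ φ ∈ l, φ.Bounded n M) :
    (disj l).Bounded n M := by
  induction l with
  | nil => trivial
  | cons φ l ih =>
    rw [List.forall_mem_cons] at hl
    exact ⟨hl.1, ih hl.2⟩

/-- The instructions that test a formula: like a positive test, they continue with the
instructions that follow if the formula is true, and skip the first of these otherwise. -/
def seg : Form → List Prim
  | const true => [.jmp 1]
  | const false => [.jmp 2]
  | inp i => [.ptst (.act (.inp i) .get)]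
  | par p => [.ptst (.reply p)]
  | not φ => seg φ ++ [.jmp 2]
  | and φ ψ => seg φ ++ .jmp 2 :: .jmp ((seg ψ).length + 2) :: seg ψ
  | or φ ψ => seg φ ++ .jmp ((seg ψ).length + 1) :: seg ψ

theorem allowed_seg (φ : Form) : ∀ u ∈ φ.seg, AllowedPrim u := by
  induction φ with
  | const v => cases v <;> simp [seg, AllowedPrim]
  | inp i => simp [seg, AllowedPrim, AllowedBasic]
  | par p => simp [seg, AllowedPrim, AllowedBasic]
  | not φ ih => simpa [seg, or_imp, forall_and, AllowedPrim] using ih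
  | and φ ψ ih₁ ih₂ => simpa [seg, or_imp, forall_and, AllowedPrim] using ⟨ih₁, ih₂⟩
  | or φ ψ ih₁ ih₂ => simpa [seg, or_imp, forall_and, AllowedPrim] using ⟨ih₁, ih₂⟩

/-- The instruction sequence of a formula acts as a test in every interpretation `ev` of threads in
which the inputs and parameters have definite values. -/
theorem extract_seg {α : Type*} (ev : Thread → α) {n M : ℕ} {b c : ℕ → Bool}
    (hb : ∀ i < n, ∀ x y, ev (.pcc x (.act (.inp i) .get) y) = cond (b i) (ev x) (ev y))
    (hc : ∀ p < M, ∀ x y, ev (.pcc x (.reply p) y) = cond (c p) (ev x) (ev y))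
    {φ : Form} (hφ : φ.Bounded n M) (Y : List Prim) :
    ev (extract (φ.seg ++ Y)) = cond (φ.eval b c) (ev (extract Y)) (ev (extract (Y.drop 1))) := by
  induction φ generalizing Y with
  | const v => cases v <;> simp [seg, extract, eval]
  | inp i => simp only [seg, List.cons_append, List.nil_append, extract, hb i hφ, eval]
  | par p => simp only [seg, List.cons_append, List.nil_append, extract, hc p hφ, eval]
  | not φ ih =>
    rw [seg, List.append_assoc, ih hφ, eval]
    cases φ.eval b c <;> simp [extract]
  | and φ ψ ih₁ ih₂ =>
    rw [seg, List.append_assoc, ih₁ hφ.1, eval]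
    cases φ.eval b c
    · have h : (ψ.seg ++ Y).drop (ψ.seg.length + 1) = Y.drop 1 := by simp
      simp [extract, h]
    · simp [extract, ih₂ hφ.2]
  | or φ ψ ih₁ ih₂ =>
    rw [seg, List.append_assoc, ih₁ hφ.1, eval]
    cases φ.eval b c
    · simp [ih₂ hφ.2]
    · simp [extract]

/-- The instruction sequence that guesses the values of the parameters below `M` and sets the
output register if they make the formula true. -/
def program (M : ℕ) (φ : Form) : List Prim :=
  (List.range M).map (fun p => .plain (.split p)) ++
    (φ.seg ++ [.plain (.act .out (.set true)), .halt])

theorem allowed_program (M : ℕ) (φ : Form) : ∀ u ∈ program M φ, AllowedPrim u := by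
  have := φ.allowed_seg
  intro u hu
  simp only [program, List.mem_append, List.mem_map, List.mem_cons, List.not_mem_nil] at hu
  rcases hu with ⟨p, -, rfl⟩ | hu | rfl | rfl | hu
  · trivial
  · exact this u hu
  · trivial
  · trivial
  · exact hu.elim

/-- Splitting on distinct parameters does not lead to deadlock if the remaining instructions do
not when values have been given to all of these parameters. -/
theorem isSome_run_splits (β : ℕ → Option Bool) (Y : List Prim) (ps : List ℕ) (hps : ps.Nodup)
    (σ : ℕ → Option Bool) (hσ : ∀ p ∈ ps, σ p = none)
    (hY : ∀ τ : ℕ → Option Bool, (∀ p, p ∈ ps ∨ (σ p).isSome → (τ p).isSome) →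
      ((extract Y).run β τ).isSome) :
    ((extract (ps.map (fun p => Prim.plain (.split p)) ++ Y)).run β σ).isSome := by
  induction ps generalizing σ with
  | nil => exact hY σ fun p hp => by simpa using hp
  | cons p ps ih =>
    rw [List.nodup_cons] at hps
    rw [List.forall_mem_cons] at hσ
    have key (v : Bool) := ih hps.2 (Function.update σ p (some v))
      (fun q hq => by
        rw [Function.update_of_ne (by rintro rfl; exact hps.1 hq)]
        exact hσ.2 q hq)
      (fun τ hτ => hY τ fun q hq => hτ q (by
        by_cases hqp : q = p
        · subst hqp; simp
        · simpa [Function.update_of_ne hqp, hqp] using hq))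
    obtain ⟨v₁, h₁⟩ := Option.isSome_iff_exists.1 (key true)
    obtain ⟨v₂, h₂⟩ := Option.isSome_iff_exists.1 (key false)
    simp [extract, Thread.run, hσ.1, h₁, h₂]

theorem path_splits (b c : ℕ → Bool) (Y : List Prim) (ps : List ℕ) :
    (extract (ps.map (fun p => Prim.plain (.split p)) ++ Y)).path b c =
      (extract Y).path b c := by
  induction ps with
  | nil => rfl
  | cons p ps ih => simp [extract, Thread.path, ih]

theorem splittingComputes_program {n M : ℕ} {φ : Form} (hφ : φ.Bounded n M)
    {f : (Fin n → Bool) → Bool}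
    (hf : ∀ b : ℕ → Bool, f (fun i => b i) = true ↔ ∃ c, φ.eval b c = true) :
    SplittingComputes (program M φ) f := by
  rw [splittingComputes_iff (allowed_program M φ)]
  intro a
  obtain ⟨b, rfl⟩ := exists_fin_eq a
  have hβ (i : ℕ) (hi : i < n) : Thread.inputs (fun i : Fin n => b i) i = some (b i) := by
    simp [Thread.inputs, hi]
  obtain ⟨v, hv⟩ : ∃ v, (extract (program M φ)).run (Thread.inputs fun i : Fin n => b i)
      (fun _ => none) = some v := by
    refine Option.isSome_iff_exists.1 (isSome_run_splits _ _ _ List.nodup_range _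
      (fun _ _ => rfl) fun τ hτ => ?_)
    have hτ' (p : ℕ) (hp : p < M) : τ p = some ((τ p).getD false) := by
      obtain ⟨v, hv⟩ := Option.isSome_iff_exists.1 (hτ p (by simp [hp]))
      simp [hv]
    rw [extract_seg (Thread.run _ τ) (n := n) (M := M) (b := b) (c := fun p => (τ p).getD false)
      ?_ ?_ hφ]
    · cases φ.eval b fun p => (τ p).getD false <;> simp [extract, Thread.run]
    · intro i hi x y
      simp only [Thread.run, hβ i hi, Option.bind_some]
    · intro p hp x y
      rw [Thread.run, hτ' p hp, Option.bind_some, Option.getD_some]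
  rw [hv, Option.some_inj, Bool.eq_iff_iff, hf, Thread.run_eq_some (b := b) ?_ hv]
  · refine exists_congr fun c => ?_
    rw [program, path_splits, extract_seg (Thread.path b c) (n := n) (M := M) (b := b) (c := c)
      (fun _ _ _ _ => rfl) (fun _ _ _ _ => rfl) hφ]
    cases φ.eval b c <;> simp [extract, Thread.path]
  · intro i w hw
    by_cases hi : i < n
    · simpa [Thread.inputs, hi] using hw
    · simp [Thread.inputs, hi] at hw

end Form

/-! ### Circuits as formulas about guessed gate values -/

section

variable (n q : ℕ)

/-- The formula for the bit at position `t` of the encoding of a pair that consists of the inputs,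
`n` in number, and of the parameters (from 0 on). -/
def codeForm (t : ℕ) : Form :=
  if t < 2 * n then .inp (t / 2) else if t = 2 * n then .const false
  else if t = 2 * n + 1 then .const true else .par (t - (2 * n + 2))

theorem eval_codeForm (b c : ℕ → Bool) (t : ℕ) :
    (codeForm n t).eval b c = codeAt n b c t := by
  unfold codeForm codeAt
  split_ifs <;> rfl

/-- The formula for the value of a node: gate `j` is represented by the parameter `q + j`. -/
def nodeForm {m k : ℕ} : Fin m ⊕ Fin k → Form :=
  Sum.elim (fun t => codeForm n t) (fun j => .par (q + j))

/-- The formula for the value of a gate in terms of the guessed values of its predecessors. -/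
def Gate.form {m k : ℕ} : Gate m k → Form
  | .const v => .const v
  | .not u => .not (nodeForm n q u)
  | .and u v => .and (nodeForm n q u) (nodeForm n q v)
  | .or u v => .or (nodeForm n q u) (nodeForm n q v)

/-- The formula saying that the guessed gate values are right. -/
def Gates.form {m : ℕ} : {k : ℕ} → Gates m k → Form
  | _, .nil => .const true
  | _, .snoc (k := k) C g => .and (Gates.form C) (.iff (.par (q + k)) (g.form n q))

/-- The formula saying that the guessed gate values are right and that the circuit yields `true`. -/
def Circuit.form {m : ℕ} (C : Circuit m) : Form :=
  .and (C.gates.form n q) (nodeForm n q C.output)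

variable {n q}

theorem eval_nodeForm {m k : ℕ} {b c : ℕ → Bool} {y : Fin k → Bool}
    (hy : ∀ j : Fin k, c (q + j) = y j)
    (u : Fin m ⊕ Fin k) :
    (nodeForm n q u).eval b c = Sum.elim (fun t : Fin m => codeAt n b c t) y u := by
  cases u with
  | inl t => exact eval_codeForm n b c t
  | inr j => exact hy j

theorem eval_gateForm {m k : ℕ} {b c : ℕ → Bool} {y : Fin k → Bool}
    (hy : ∀ j : Fin k, c (q + j) = y j)
    (g : Gate m k) :
    (g.form n q).eval b c = g.eval (fun t => codeAt n b c t) y := by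
  cases g <;> simp only [Gate.form, Form.eval, Gate.eval, eval_nodeForm hy]

theorem eval_gatesForm {m k : ℕ} (b c : ℕ → Bool) (C : Gates m k) :
    (C.form n q).eval b c = true ↔
      ∀ j : Fin k, c (q + j) = C.eval (fun t => codeAt n b c t) j := by
  induction C with
  | nil => simp [Gates.form, Form.eval]
  | @snoc k C g ih =>
    rw [Gates.form, Form.eval, Bool.and_eq_true, ih, Fin.forall_fin_succ']
    simp only [Gates.eval, Fin.snoc_castSucc, Fin.snoc_last, Fin.val_castSucc, Fin.val_last]
    refine and_congr_right fun h => ?_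
    rw [Form.eval_iff, beq_iff_eq, eval_gateForm h]
    rfl

theorem eval_circuitForm {m : ℕ} (b c : ℕ → Bool) (C : Circuit m) :
    (C.form n q).eval b c = true ↔
      (∀ j : Fin C.numGates, c (q + j) = C.gates.eval (fun t => codeAt n b c t) j) ∧
        C.eval (fun t => codeAt n b c t) = true := by
  rw [Circuit.form, Form.eval, Bool.and_eq_true, eval_gatesForm]
  refine and_congr_right fun h => ?_
  rw [eval_nodeForm h]
  rfl

/-- The formula of a circuit is satisfiable if and only if the circuit accepts a certificate: the
gate values can always be guessed right, because the parameters for them are not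
used for the certificate. -/
theorem exists_eval_circuitForm {l : ℕ} (hl : l ≤ q) (b : ℕ → Bool)
    (C : Circuit (2 * n + 2 + l)) :
    (∃ c, (C.form n q).eval b c = true) ↔
      ∃ c : ℕ → Bool, C.eval (fun t => codeAt n b c t) = true := by
  constructor
  · rintro ⟨c, hc⟩
    exact ⟨c, ((eval_circuitForm b c C).1 hc).2⟩
  · rintro ⟨c, hc⟩
    obtain ⟨y, hy⟩ := exists_fin_eq (C.gates.eval fun t : Fin (2 * n + 2 + l) => codeAt n b c t)
    refine ⟨fun p => if p < q then c p else y (p - q), ?_⟩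
    have hcode : (fun t : Fin (2 * n + 2 + l) =>
        codeAt n b (fun p => if p < q then c p else y (p - q)) t) = fun t => codeAt n b c t.1 := by
      funext t
      have := t.2
      simp only [codeAt]
      split_ifs <;> first | rfl | omega
    rw [eval_circuitForm, hcode]
    refine ⟨fun j => ?_, hc⟩
    rw [hy]
    simp

theorem bounded_nodeForm {m k M : ℕ} (hm : m ≤ 2 * n + 2 + q) (hk : q + k ≤ M)
    (u : Fin m ⊕ Fin k) :
    (nodeForm n q u).Bounded n M := by
  cases u with
  | inl t =>
    have := t.2
    simp only [nodeForm, Sum.elim_inl, codeForm]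
    split_ifs <;> simp only [Form.Bounded] <;> omega
  | inr j =>
    have := j.2
    simp only [nodeForm, Sum.elim_inr, Form.Bounded]
    omega

theorem bounded_gatesForm {m k M : ℕ} (hm : m ≤ 2 * n + 2 + q) (hk : q + k ≤ M) (C : Gates m k) :
    (C.form n q).Bounded n M := by
  induction C with
  | nil => trivial
  | @snoc k C g ih =>
    have hp : (Form.par (q + k)).Bounded n M := by simp only [Form.Bounded]; omega
    have hu := fun u => bounded_nodeForm (m := m) (k := k) hm (by omega : q + k ≤ M) u
    have hg : (g.form n q).Bounded n M := by
      cases g with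
      | const v => trivial
      | not u => exact hu u
      | and u v => exact ⟨hu u, hu v⟩
      | or u v => exact ⟨hu u, hu v⟩
    exact ⟨ih (by omega), ⟨hp, hg⟩, hp, hg⟩

theorem bounded_circuitForm {m M : ℕ} (hm : m ≤ 2 * n + 2 + q) (C : Circuit m)
    (hC : q + C.numGates ≤ M) : (C.form n q).Bounded n M :=
  ⟨bounded_gatesForm hm hC C.gates, bounded_nodeForm hm hC C.output⟩

theorem length_seg_nodeForm {m k : ℕ} (u : Fin m ⊕ Fin k) : (nodeForm n q u).seg.length = 1 := by
  cases u with
  | inl t =>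
    simp only [nodeForm, Sum.elim_inl, codeForm]
    split_ifs <;> rfl
  | inr j => rfl

theorem length_seg_gatesForm {m k : ℕ} (C : Gates m k) :
    (C.form n q).seg.length ≤ 19 * k + 1 := by
  induction C with
  | nil => simp [Gates.form, Form.seg]
  | @snoc k C g ih =>
    have hg : (g.form n q).seg.length ≤ 4 := by
      cases g with
      | const v => cases v <;> simp [Gate.form, Form.seg]
      | _ => simp [Gate.form, Form.seg, length_seg_nodeForm]
    simp only [Gates.form, Form.iff, Form.seg, List.length_append, List.length_cons,
      List.length_nil]
    omega

theorem length_seg_circuitForm {m : ℕ} (C : Circuit m) :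
    (C.form n q).seg.length ≤ 19 * C.numGates + 4 := by
  have := length_seg_gatesForm (n := n) (q := q) C.gates
  simp only [Circuit.form, Form.seg, List.length_append, List.length_cons, length_seg_nodeForm]
  omega

theorem length_seg_disj {l : List Form} {B : ℕ} (hl : ∀ φ ∈ l, φ.seg.length ≤ B) :
    (Form.disj l).seg.length ≤ l.length * (B + 1) + 1 := by
  induction l with
  | nil => simp [Form.disj, Form.seg]
  | cons φ l ih =>
    rw [List.forall_mem_cons] at hl
    have := ih hl.2
    have := hl.1
    rw [Form.disj, List.foldr_cons, ← Form.disj, Form.seg, List.length_append, List.length_cons,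
      List.length_cons, Nat.add_mul]
    omega

end

theorem exists_mem_PLSIS_of_mem_NPPoly {F : List Bool → Bool} (hF : F ∈ NPPoly) :
    ∃ f ∈ PLSIS, familyEquiv f = F := by
  obtain ⟨k, g, ⟨h, hC⟩, hg⟩ := hF
  choose C hCg hCh using hC
  refine ⟨familyEquiv.symm F, ?_, familyEquiv.apply_symm_apply F⟩
  -- the number of gates of the circuits for codes of strings of length `n` and their certificates
  let G : Polynomial ℕ := h.comp (2 * Polynomial.X + 2 + Polynomial.X ^ k)
  have hG (n : ℕ) : G.eval n = h.eval (2 * n + 2 + n ^ k) := by simp [G, Polynomial.eval_comp]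
  have hgates {n l : ℕ} (hl : l ≤ n ^ k) : (C (2 * n + 2 + l)).numGates ≤ G.eval n := by
    have h₁ := hCh (2 * n + 2 + l)
    have h₂ := eval_mono h (show 2 * n + 2 + l ≤ 2 * n + 2 + n ^ k by omega)
    rw [hG]
    simp only [Circuit.size] at h₁ h₂
    omega
  refine ⟨Polynomial.X ^ k + G + (Polynomial.X ^ k + 1) * (19 * G + 5) + 3, fun n => ?_⟩
  let forms : List Form :=
    (List.range (n ^ k + 1)).map fun l => (C (2 * n + 2 + l)).form n (n ^ k)
  have hforms (P : Form → Prop) (hP : ∀ l ≤ n ^ k, P ((C (2 * n + 2 + l)).form n (n ^ k))) :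
      ∀ φ ∈ forms, P φ := by
    intro φ hφ
    obtain ⟨l, hl, rfl⟩ := List.mem_map.1 hφ
    exact hP l (Nat.lt_succ_iff.1 (List.mem_range.1 hl))
  refine ⟨Form.program (n ^ k + G.eval n) (Form.disj forms),
    ⟨by simp [Form.program], Form.allowed_program _ _⟩,
    Form.splittingComputes_program (Form.bounded_disj (hforms _ fun l hl => ?_)) fun b => ?_, ?_⟩
  · have := hgates hl
    exact bounded_circuitForm (by omega) _ (by omega)
  · have hcode (l : ℕ) (c : ℕ → Bool) :
        (C (2 * n + 2 + l)).eval (fun t => codeAt n b c t) =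
          g (pairCode ((List.range n).map b) ((List.range l).map c)) := by
      rw [hCg, ofFn_eq_map_range, pairCode_map_range]
    have hF : familyEquiv.symm F n (fun i => b i) = F ((List.range n).map b) := by
      rw [← ofFn_eq_map_range]; rfl
    rw [hF, hg]
    simp only [Form.eval_disj, List.length_map, List.length_range]
    constructor
    · rintro ⟨c, hc, hgc⟩
      obtain ⟨c', hc'⟩ := exists_eq_map_range c
      rw [hc', ← hcode] at hgc
      obtain ⟨c'', h''⟩ := (exists_eval_circuitForm hc b _).2 ⟨c', hgc⟩
      exact ⟨c'', _, List.mem_map.2 ⟨_, List.mem_range.2 (Nat.lt_succ_iff.2 hc), rfl⟩, h''⟩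
    · rintro ⟨c, φ, hφ, hc⟩
      obtain ⟨l, hl, rfl⟩ := List.mem_map.1 hφ
      have hl := Nat.lt_succ_iff.1 (List.mem_range.1 hl)
      obtain ⟨c', hc'⟩ := (exists_eval_circuitForm hl b _).1 ⟨c, hc⟩
      rw [hcode] at hc'
      exact ⟨_, by simpa using hl, hc'⟩
  · have hlen := length_seg_disj (l := forms) (hforms _ fun l hl =>
      (length_seg_circuitForm (n := n) (q := n ^ k) (C (2 * n + 2 + l))).trans
        (Nat.add_le_add_right (Nat.mul_le_mul_left 19 (hgates hl)) 4))
    have hfl : forms.length = n ^ k + 1 := by simp [forms]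
    rw [hfl, show 19 * G.eval n + 4 + 1 = 19 * G.eval n + 5 from rfl] at hlen
    simp only [Form.program, List.length_append, List.length_map, List.length_range,
      List.length_cons, List.length_nil, Polynomial.eval_add, Polynomial.eval_mul,
      Polynomial.eval_pow, Polynomial.eval_X, Polynomial.eval_ofNat, Polynomial.eval_one]
    omega

end SplitInstr

theorem mainTheorem2 :
    SplitInstr.familyEquiv '' SplitInstr.PLSIS = SplitInstr.NPPoly := by
  ext F
  constructor
  · rintro ⟨f, hf, rfl⟩
    exact SplitInstr.mem_NPPoly_of_mem_PLSIS hf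
  · exact SplitInstr.exists_mem_PLSIS_of_mem_NPPoly
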